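/- Call a family $\mathscr U$ of subsets of a set $X$ separating if for all distinct $x,y\in X$ there is $U\in\mathscr U$ such that $\{x,y\}\cap U$ is a singleton. A topological space $X$ is called Gruenhage if it has a separating family $\mathscr U$ of open sets that can be written as $\mathscr U=\bigcup_{n\in\mathbb N}\mathscr U_n$ in such a way that, for all distinct $x,y\in X$, there is $n\in\mathbb N$ such that (i) $\{x,y\}\cap U$ is a singleton for some $U\in\mathscr U_n$, and (ii) $\{U\in\mathscr U_n : x\in U\}$ is finite or $\{U\in\mathscr U_n : y\in U\}$ is finite. A space is called Gruenhage compact if it is compact, Hausdorff and Gruenhage. **Proposition 5.4.** Let $K$ be a Gruenhage compact space, let $C(K)$ be the Banach space of continuous real-valued functions on $K$ with the supremum norm, and let $B_{C(K)^*}$ be the closed unit ball of its dual space. Then $B_{C(K)^*}$, with the topology induced by the weak* topology $\sigma(C(K)^*,C(K))$, is Gruenhage compact. -/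

import Mathlib

namespace GruenhageSpaces

/-- A family `𝒰` of subsets of `X` is (`T₀`-)separating if for distinct `x, y` there is
`U ∈ 𝒰` such that `{x, y} ∩ U` is a singleton. -/
def IsSeparating {X : Type*} (𝒰 : Set (Set X)) : Prop :=
  ∀ x y : X, x ≠ y → ∃ U ∈ 𝒰, ∃ z : X, {x, y} ∩ U = {z}

/-- The order of the point `x` in the family `𝒰`: the number of members of `𝒰` containing `x`
(with the value `⊤` if there are infinitely many of them). -/
noncomputable def pointOrder {X : Type*} (x : X) (𝒰 : Set (Set X)) : ℕ∞ :=
  Set.encard {U | U ∈ 𝒰 ∧ x ∈ U}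

/-- A separating family `𝒰` is `σ`-distributively point finite if it is the union of a sequence of
subfamilies such that any two distinct points `x, y` are separated by a member of some `n`-th
subfamily in which, for the same `n`, at least one of `x, y` has finite order. -/
def IsSigmaDistributivelyPointFinite {X : Type*} (𝒰 : Set (Set X)) : Prop :=
  IsSeparating 𝒰 ∧
    ∃ 𝒱 : ℕ → Set (Set X), 𝒰 = ⋃ n, 𝒱 n ∧
      ∀ x y : X, x ≠ y → ∃ n : ℕ,
        (∃ U ∈ 𝒱 n, ∃ z : X, {x, y} ∩ U = {z}) ∧
          (pointOrder x (𝒱 n) < ⊤ ∨ pointOrder y (𝒱 n) < ⊤)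

/-- A topological space is Gruenhage if it admits a `σ`-distributively point finite separating
family of open sets. -/
def IsGruenhage (X : Type*) [TopologicalSpace X] : Prop :=
  ∃ 𝒰 : Set (Set X), (∀ U ∈ 𝒰, IsOpen U) ∧ IsSigmaDistributivelyPointFinite 𝒰

/-- A Gruenhage compact space: a compact Hausdorff space that is Gruenhage. -/
structure IsGruenhageCompact (X : Type*) [TopologicalSpace X] : Prop where
  compact : CompactSpace X
  hausdorff : T2Space X
  gruenhage : IsGruenhage X

/-- The closed unit ball (for the dual norm) of the dual of a real normed space `E`, as a subset of
the dual with its weak* topology. -/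
def dualUnitBall (E : Type*) [NormedAddCommGroup E] [NormedSpace ℝ E] : Set (WeakDual ℝ E) :=
  {f | ‖WeakDual.toStrongDual f‖ ≤ 1}

end GruenhageSpaces

/-! Compactness is Banach–Alaoglu. For the Gruenhage property, sort the points of `K` by which
members of the `n`-th family contain them: those lying in exactly the `k` members of a finite `F`
form a difference `V \ R` of open sets. For fixed `(n, k)` these are disjoint, and together they
separate points (`IsGruenhage.exists_disjoint_families`). Finite inner regular measures are
determined by their total mass and their values on finite intersections of these pieces
(`measure_ext_of_disjoint_families`).

A functional is determined by the measures of its positive and negative parts, whose values on open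
sets are weak* lower semicontinuous. Each finite intersection of pieces is `G \ RA` with `RA ⊆ G`
open, so the conditions `q < m (RA)` and `q < m (G)`, with `q` rational, give open sets separating
functionals. The order is finite where needed: if `m (RA) < q`, then every `G` with `m (G) > q`
contributes mass at least `q - m (RA)` outside `RA`, and disjointness permits only finitely many
(`isGruenhage_of_measures`). -/

namespace GruenhageSpaces
open MeasureTheory Set
open scoped ENNReal NNReal

/-! ### Uniqueness of finite inner regular measures. -/

section Measures

variable {X : Type*} [TopologicalSpace X] [T2Space X] [MeasurableSpace X] [BorelSpace X]

/-- If countably many measurable sets separate the points outside a null set, then two finite inner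
regular measures that agree on the `σ`-algebra generated by these sets are equal. -/
theorem measure_ext_of_countable_separating {P : Type*} [Countable P] {D : P → Set X}
    (hD : ∀ p, MeasurableSet (D p)) (μ ν : Measure X) [IsFiniteMeasure μ] [IsFiniteMeasure ν]
    [μ.InnerRegular] [ν.InnerRegular] {N : Set X} (hN : (μ + ν) N = 0)
    (hsep : ∀ x ∉ N, ∀ y ∉ N, (∀ p, x ∈ D p ↔ y ∈ D p) → x = y)
    (hagree : ∀ S : Set (P → Prop), MeasurableSet S →
      μ ((fun x p => x ∈ D p) ⁻¹' S) = ν ((fun x p => x ∈ D p) ⁻¹' S)) :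
    μ = ν := by
  classical
  set l : Measure X := μ + ν with hl
  -- A Lusin-type reduction: off a set of measure at most `ε`, all the `D p` become relatively
  -- clopen in one compact set that misses `N`.
  have key : ∀ ε : ℝ≥0∞, ε ≠ 0 → ∃ M : Set X, IsCompact M ∧ l Mᶜ ≤ ε ∧ M ⊆ Nᶜ ∧
      ∀ p, IsClosed (D p ∩ M) ∧ IsClosed ((D p)ᶜ ∩ M) := by
    intro ε hε
    obtain ⟨δ, hδ, hδs⟩ := ENNReal.exists_pos_sum_of_countable' (ENNReal.half_pos hε).ne' P
    have hδ0 : ∀ p, δ p / 2 ≠ 0 := fun p => (ENNReal.half_pos (hδ p).ne').ne'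
    choose C hCD hC hCl using fun p =>
      (hD p).exists_isCompact_sdiff_lt (μ := l) (measure_ne_top _ _) (hδ0 p)
    choose C' hCD' hC' hCl' using fun p =>
      (hD p).compl.exists_isCompact_sdiff_lt (μ := l) (measure_ne_top _ _) (hδ0 p)
    obtain ⟨M₀, hM₀N, hM₀, hM₀l⟩ :=
      (measurableSet_toMeasurable l N).compl.exists_isCompact_sdiff_lt (μ := l)
        (measure_ne_top _ _) (ENNReal.half_pos hε).ne'
    have hcl : ∀ p, IsClosed (C p ∪ C' p) := fun p => (hC p).isClosed.union (hC' p).isClosed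
    refine ⟨M₀ ∩ ⋂ p, (C p ∪ C' p), hM₀.inter_right (isClosed_iInter hcl), ?_, ?_, ?_⟩
    · have hsub : (M₀ ∩ ⋂ p, (C p ∪ C' p))ᶜ ⊆ toMeasurable l N ∪
          ((toMeasurable l N)ᶜ \ M₀) ∪ ⋃ p, ((D p \ C p) ∪ ((D p)ᶜ \ C' p)) := by
        intro x hx
        simp only [mem_compl_iff, mem_inter_iff, mem_iInter, mem_union, mem_iUnion,
          mem_sdiff] at hx ⊢
        by_cases h0 : x ∈ M₀
        · right
          have : ∃ p, ¬ (x ∈ C p ∨ x ∈ C' p) := by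
            by_contra! h
            exact hx ⟨h0, h⟩
          obtain ⟨p, hp⟩ := this
          exact ⟨p, by tauto⟩
        · left; tauto
      calc l (M₀ ∩ ⋂ p, (C p ∪ C' p))ᶜ ≤ _ := measure_mono hsub
        _ ≤ (l (toMeasurable l N) + l ((toMeasurable l N)ᶜ \ M₀)) +
            l (⋃ p, ((D p \ C p) ∪ ((D p)ᶜ \ C' p))) :=
          (measure_union_le _ _).trans (by gcongr; exact measure_union_le _ _)
        _ ≤ (0 + ε / 2) + ∑' p, δ p := by
          gcongr
          · rw [measure_toMeasurable, hN]
          · refine (measure_iUnion_le _).trans (ENNReal.tsum_le_tsum fun p => ?_)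
            refine (measure_union_le _ _).trans ?_
            calc _ ≤ δ p / 2 + δ p / 2 := add_le_add (hCl p).le (hCl' p).le
              _ = δ p := ENNReal.add_halves _
        _ ≤ ε / 2 + ε / 2 := by rw [zero_add]; gcongr
        _ = ε := ENNReal.add_halves _
    · intro x hx hxN
      exact hM₀N hx.1 (subset_toMeasurable _ _ hxN)
    · intro p
      have hM : ∀ x ∈ M₀ ∩ ⋂ p, (C p ∪ C' p), x ∈ C p ∨ x ∈ C' p := fun x hx =>
        mem_iInter.1 hx.2 p
      have hMc : IsClosed (M₀ ∩ ⋂ p, (C p ∪ C' p)) := hM₀.isClosed.inter (isClosed_iInter hcl)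
      constructor
      · have : D p ∩ (M₀ ∩ ⋂ p, (C p ∪ C' p)) = C p ∩ (M₀ ∩ ⋂ p, (C p ∪ C' p)) := by
          ext x
          exact ⟨fun h => ⟨(hM x h.2).resolve_right fun h' => hCD' p h' h.1, h.2⟩,
            fun h => ⟨hCD p h.1, h.2⟩⟩
        rw [this]
        exact (hC p).isClosed.inter hMc
      · have : (D p)ᶜ ∩ (M₀ ∩ ⋂ p, (C p ∪ C' p)) = C' p ∩ (M₀ ∩ ⋂ p, (C p ∪ C' p)) := by
          ext x
          exact ⟨fun h => ⟨(hM x h.2).resolve_left fun h' => h.1 (hCD p h'), h.2⟩,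
            fun h => ⟨hCD' p h.1, h.2⟩⟩
        rw [this]
        exact (hC' p).isClosed.inter hMc
  have hle : ∀ C : Set X, IsClosed C → μ C ≤ ν C ∧ ν C ≤ μ C := by
    intro C hC
    have aux : ∀ ε : ℝ≥0∞, ε ≠ 0 → μ C ≤ ν C + (ε + ε) ∧ ν C ≤ μ C + (ε + ε) := by
      intro ε hε
      obtain ⟨M, hM, hMl, hMN, hMD⟩ := key ε hε
      -- On `M` this map is continuous and injective, so the image of `C ∩ M` is compact, and the
      -- preimage of that image differs from `C` only outside `M`.
      let Ψ : X → P → Bool := fun x p => decide (x ∈ D p)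
      have hΨ : ContinuousOn Ψ M := by
        rw [continuousOn_pi]
        intro p
        rw [continuousOn_iff_continuous_domRestrict, continuous_discrete_rng]
        intro b
        rw [← isClosed_compl_iff]
        have h1 : (M.domRestrict (fun x => Ψ x p) ⁻¹' {b})ᶜ = M.domRestrict (fun x => Ψ x p) ⁻¹' {!b} := by
          ext x
          cases b <;> simp
        rw [h1]
        cases b
        · convert (hMD p).1.preimage (continuous_subtype_val (p := (· ∈ M))) using 1
          ext x; simp [Ψ]
        · convert (hMD p).2.preimage (continuous_subtype_val (p := (· ∈ M))) using 1
          ext x; simp [Ψ]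
      have hcomp : IsCompact (Ψ '' (C ∩ M)) :=
        (hM.inter_left hC).image_of_continuousOn (hΨ.mono inter_subset_right)
      set S := Ψ '' (C ∩ M) with hS
      let T : Set (P → Prop) := (fun q p => decide (q p)) ⁻¹' S
      have hT : MeasurableSet T := by
        have : Measurable (fun (q : P → Prop) (p : P) => decide (q p)) := by
          rw [measurable_pi_iff]
          intro p
          exact (measurable_of_countable (fun q : Prop => decide q)).comp (measurable_pi_apply p)
        exact this hcomp.isClosed.measurableSet
      have hE := hagree T hT
      set E := (fun (x : X) (p : P) => x ∈ D p) ⁻¹' T with hEdef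
      have hEΨ : E = Ψ ⁻¹' S := by
        ext x; simp only [hEdef, T, Ψ, mem_preimage]
      have h1 : C ⊆ E ∪ Mᶜ := by
        intro x hx
        by_cases hxM : x ∈ M
        · left; rw [hEΨ]; exact ⟨x, ⟨hx, hxM⟩, rfl⟩
        · exact Or.inr hxM
      have h2 : E ⊆ C ∪ Mᶜ := by
        intro x hx
        by_cases hxM : x ∈ M
        · left
          rw [hEΨ] at hx
          obtain ⟨y, hy, hyx⟩ := hx
          have : y = x := hsep y (hMN hy.2) x (hMN hxM) fun p => by
            simpa [Ψ] using congrFun hyx p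
          exact this ▸ hy.1
        · exact Or.inr hxM
      have hμ : μ Mᶜ ≤ ε := le_trans (by simp [hl]) hMl
      have hν : ν Mᶜ ≤ ε := le_trans (by simp [hl]) hMl
      constructor
      · calc μ C ≤ μ E + μ Mᶜ := (measure_mono h1).trans (measure_union_le _ _)
          _ ≤ ν E + ε := by rw [hE]; gcongr
          _ ≤ (ν C + ν Mᶜ) + ε := by gcongr; exact (measure_mono h2).trans (measure_union_le _ _)
          _ ≤ ν C + (ε + ε) := by rw [add_assoc]; gcongr
      · calc ν C ≤ ν E + ν Mᶜ := (measure_mono h1).trans (measure_union_le _ _)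
          _ ≤ μ E + ε := by rw [hE]; gcongr
          _ ≤ (μ C + μ Mᶜ) + ε := by gcongr; exact (measure_mono h2).trans (measure_union_le _ _)
          _ ≤ μ C + (ε + ε) := by rw [add_assoc]; gcongr
    constructor
    · refine ENNReal.le_of_forall_pos_le_add fun ε hε _ => ?_
      have := (aux (ε / 2) (by simpa using hε.ne')).1
      rwa [ENNReal.add_halves] at this
    · refine ENNReal.le_of_forall_pos_le_add fun ε hε _ => ?_
      have := (aux (ε / 2) (by simpa using hε.ne')).2
      rwa [ENNReal.add_halves] at this
  have hcl : ∀ C : Set X, IsClosed C → μ C = ν C := fun C hC => le_antisymm (hle C hC).1 (hle C hC).2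
  refine ext_of_generate_finite {C : Set X | IsClosed C} ?_ isPiSystem_isClosed hcl
    (hcl _ isClosed_univ)
  rw [‹BorelSpace X›.measurable_eq, borel_eq_generateFrom_isClosed]

omit [T2Space X] in
/-- If `V j` are open and the sets `V j \ R` are null, then so is their union. -/
theorem measure_iUnion_diff_eq_zero {J : Type*} {V : J → Set X} (hV : ∀ j, IsOpen (V j)) {R : Set X}
    (hR : MeasurableSet R) (l : Measure X) [l.InnerRegular]
    (h0 : ∀ j, l (V j \ R) = 0) : l (⋃ j, V j \ R) = 0 := by
  rw [← iUnion_sdiff]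
  by_contra h
  -- `J` may be uncountable; passing to a compact subset of positive measure leaves only finitely
  -- many `V j` to consider.
  obtain ⟨Q, hQ, hQc, hQ0⟩ := ((isOpen_iUnion hV).measurableSet.diff hR).exists_lt_isCompact
    (μ := l) (pos_iff_ne_zero.2 h)
  obtain ⟨t, ht⟩ := hQc.elim_finite_subcover V hV (hQ.trans sdiff_subset)
  refine hQ0.ne' (measure_mono_null (t := ⋃ j ∈ t, V j \ R) (fun x hx => ?_) ?_)
  · obtain ⟨j, hj, hxj⟩ := mem_iUnion₂.1 (ht hx)
    exact mem_iUnion₂.2 ⟨j, hj, hxj, (hQ hx).2⟩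
  · exact (measure_biUnion_null_iff t.countable_toSet).2 fun j _ => h0 j

/-- Finite inner regular measures are determined by their values on the finite intersections of
the members of a countable collection of disjoint families `fun j ↦ V a j \ R a`, with `V a j` and
`R a` open, that together separate points. -/
theorem measure_ext_of_disjoint_families {ι J : Type*} [Countable ι]
    {V : ι → J → Set X} {R : ι → Set X} (hV : ∀ a j, IsOpen (V a j)) (hR : ∀ a, IsOpen (R a))
    (hdisj : ∀ a, Pairwise fun j k => Disjoint (V a j \ R a) (V a k \ R a))
    (hsep : ∀ x y, (∀ a j, x ∈ V a j \ R a ↔ y ∈ V a j \ R a) → x = y)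
    (μ ν : Measure X) [IsFiniteMeasure μ] [IsFiniteMeasure ν]
    [μ.InnerRegular] [ν.InnerRegular]
    (h : ∀ (A : Finset ι) (i : ι → J),
      μ (⋂ a ∈ A, V a (i a) \ R a) = ν (⋂ a ∈ A, V a (i a) \ R a)) (huniv : μ univ = ν univ) :
    μ = ν := by
  classical
  set l : Measure X := μ + ν with hl
  have hDm : ∀ a j, MeasurableSet (V a j \ R a) := fun a j =>
    (hV a j).measurableSet.diff (hR a).measurableSet
  -- Only countably many pieces carry mass; all the others together form the null set `N`.
  have hcount : ∀ a, {j | 0 < l (V a j \ R a)}.Countable := fun a =>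
    Measure.countable_meas_pos_of_disjoint_iUnion (hDm a) (hdisj a)
  have (a : ι) : Countable {j | 0 < l (V a j \ R a)} := (hcount a).to_subtype
  let P := Σ a, {j | 0 < l (V a j \ R a)}
  let D : P → Set X := fun p => V p.1 p.2 \ R p.1
  let N : Set X := ⋃ a, ⋃ j : {j // ¬ 0 < l (V a j \ R a)}, V a j \ R a
  have hN : l N = 0 := by
    refine measure_iUnion_null fun a => ?_
    exact measure_iUnion_diff_eq_zero
      (V := fun j : {j // ¬ 0 < l (V a j \ R a)} => V a j) (fun j => hV a j) (hR a).measurableSet l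
      fun j => by simpa using j.2
  have hpos : ∀ x ∉ N, ∀ a j, x ∈ V a j \ R a → 0 < l (V a j \ R a) := by
    intro x hx a j hxj
    by_contra hj
    exact hx (mem_iUnion.2 ⟨a, mem_iUnion.2 ⟨⟨j, hj⟩, hxj⟩⟩)
  refine measure_ext_of_countable_separating (D := D) (fun p => hDm _ _) μ ν hN ?_ ?_
  · intro x hx y hy hxy
    refine hsep x y fun a j => ⟨fun hj => ?_, fun hj => ?_⟩
    · exact (hxy ⟨a, j, hpos x hx a j hj⟩).1 hj
    · exact (hxy ⟨a, j, hpos y hy a j hj⟩).2 hj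
  · intro S hS
    let C : Set (Set X) := {s | s = ∅ ∨ ∃ (A : Finset ι) (i : ι → J), s = ⋂ a ∈ A, V a (i a) \ R a}
    have hpi : IsPiSystem C := by
      rintro s (rfl | ⟨A, i, rfl⟩) t (rfl | ⟨B, k, rfl⟩) hst
      · simp at hst
      · simp at hst
      · simp at hst
      · right
        -- A common point forces the two index choices to agree on `A ∩ B`, since pieces with the
        -- same `a` are disjoint.
        have hik : ∀ a ∈ A, a ∈ B → i a = k a := by
          intro a ha hb
          by_contra hne
          obtain ⟨x, hxA, hxB⟩ := hst
          exact (disjoint_left.1 (hdisj a hne)) (mem_iInter₂.1 hxA a ha) (mem_iInter₂.1 hxB a hb)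
        refine ⟨A ∪ B, fun a => if a ∈ A then i a else k a, ?_⟩
        ext x
        simp only [mem_inter_iff, mem_iInter, Finset.mem_union]
        constructor
        · rintro ⟨h1, h2⟩ a ha
          by_cases haA : a ∈ A
          · simpa only [if_pos haA] using h1 a haA
          · simpa only [if_neg haA] using h2 a (ha.resolve_left haA)
        · intro h1
          refine ⟨fun a ha => ?_, fun a hb => ?_⟩
          · simpa only [if_pos ha] using h1 a (Or.inl ha)
          · have := h1 a (Or.inr hb)
            by_cases haA : a ∈ A
            · simpa only [if_pos haA, hik a haA hb] using this
            · simpa only [if_neg haA] using this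
    have hCm : ∀ s ∈ C, MeasurableSet s := by
      rintro s (rfl | ⟨A, i, rfl⟩)
      · exact MeasurableSet.empty
      · exact A.measurableSet_biInter fun a _ => hDm a _
    refine ext_on_measurableSpace_of_generate_finite (m := MeasurableSpace.generateFrom C) _ C ?_
      (MeasurableSpace.generateFrom_le hCm) rfl hpi huniv ?_
    · rintro s (rfl | ⟨A, i, rfl⟩)
      · simp
      · exact h A i
    · have : Measurable[MeasurableSpace.generateFrom C] fun (x : X) (p : P) => x ∈ D p := by
        refine @measurable_pi_lambda _ _ _ (MeasurableSpace.generateFrom C) _ _ fun p => ?_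
        refine @measurable_to_prop _ (MeasurableSpace.generateFrom C) _ ?_
        refine MeasurableSpace.measurableSet_generateFrom (Or.inr ⟨{p.1}, fun _ => p.2, ?_⟩)
        ext x; simp [D]
      exact this hS

end Measures
end GruenhageSpaces
namespace GruenhageSpaces
open MeasureTheory Set CompactlySupported
open scoped ENNReal NNReal

/-! ### Positive parts of functionals and their Riesz measures. -/

section PositivePart

variable {K : Type*} [TopologicalSpace K] [CompactSpace K]

/-- The value at `f ≥ 0` of the positive part of a functional `φ` on `C(K, ℝ)`. -/
noncomputable def posPartAux (φ : C(K, ℝ) →L[ℝ] ℝ) (f : C(K, ℝ)) : ℝ :=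
  sSup (φ '' Icc 0 f)

theorem bddAbove_image_Icc (φ : C(K, ℝ) →L[ℝ] ℝ) (f : C(K, ℝ)) : BddAbove (φ '' Icc 0 f) := by
  refine ⟨‖φ‖ * ‖f‖, ?_⟩
  rintro _ ⟨g, hg, rfl⟩
  refine (le_abs_self _).trans ((φ.le_opNorm g).trans ?_)
  gcongr
  rw [ContinuousMap.norm_le _ (norm_nonneg _)]
  intro x
  have hx : 0 ≤ g x := hg.1 x
  rw [Real.norm_of_nonneg hx]
  exact (hg.2 x).trans ((le_abs_self _).trans (f.norm_coe_le_norm x))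

theorem le_posPartAux (φ : C(K, ℝ) →L[ℝ] ℝ) {f g : C(K, ℝ)} (hg : 0 ≤ g) (hgf : g ≤ f) :
    φ g ≤ posPartAux φ f :=
  le_csSup (bddAbove_image_Icc φ f) ⟨g, ⟨hg, hgf⟩, rfl⟩

omit [CompactSpace K] in
theorem posPartAux_le (φ : C(K, ℝ) →L[ℝ] ℝ) {f : C(K, ℝ)} (hf : 0 ≤ f) {c : ℝ}
    (h : ∀ g, 0 ≤ g → g ≤ f → φ g ≤ c) : posPartAux φ f ≤ c := by
  refine csSup_le ⟨_, 0, ⟨le_rfl, hf⟩, rfl⟩ ?_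
  rintro _ ⟨g, hg, rfl⟩
  exact h g hg.1 hg.2

theorem posPartAux_nonneg (φ : C(K, ℝ) →L[ℝ] ℝ) {f : C(K, ℝ)} (hf : 0 ≤ f) :
    0 ≤ posPartAux φ f := by
  simpa using le_posPartAux φ le_rfl hf

/-- Riesz decomposition: any `0 ≤ g ≤ f₁ + f₂` splits into `g ⊓ f₁ ≤ f₁` and `g - g ⊓ f₁ ≤ f₂`. -/
theorem posPartAux_add (φ : C(K, ℝ) →L[ℝ] ℝ) {f₁ f₂ : C(K, ℝ)} (h₁ : 0 ≤ f₁) (h₂ : 0 ≤ f₂) :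
    posPartAux φ (f₁ + f₂) = posPartAux φ f₁ + posPartAux φ f₂ := by
  apply le_antisymm
  · refine posPartAux_le φ (add_nonneg h₁ h₂) fun g hg hgf => ?_
    have hsplit : φ g = φ (g ⊓ f₁) + φ (g - g ⊓ f₁) := by rw [← map_add]; congr 1; abel
    rw [hsplit]
    refine add_le_add (le_posPartAux φ (le_inf hg h₁) inf_le_right)
      (le_posPartAux φ (sub_nonneg.2 inf_le_left) ?_)
    refine ContinuousMap.le_def.2 fun x => ?_
    have := ContinuousMap.le_def.1 hgf x
    have := ContinuousMap.le_def.1 h₂ x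
    simp only [ContinuousMap.coe_sub, Pi.sub_apply, ContinuousMap.inf_apply,
      ContinuousMap.coe_add, Pi.add_apply, ContinuousMap.coe_zero, Pi.zero_apply] at *
    rcases le_total (g x) (f₁ x) with h | h
    · rw [inf_eq_left.2 h]; linarith
    · rw [inf_eq_right.2 h]; linarith
  · rw [← le_sub_iff_add_le]
    refine posPartAux_le φ h₁ fun g₁ hg₁ hgf₁ => ?_
    rw [le_sub_iff_add_le, ← le_sub_iff_add_le']
    refine posPartAux_le φ h₂ fun g₂ hg₂ hgf₂ => ?_
    rw [le_sub_iff_add_le', ← map_add]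
    exact le_posPartAux φ (add_nonneg hg₁ hg₂) (add_le_add hgf₁ hgf₂)

theorem mul_posPartAux_le (φ : C(K, ℝ) →L[ℝ] ℝ) {f : C(K, ℝ)} (hf : 0 ≤ f) {c : ℝ} (hc : 0 < c) :
    c * posPartAux φ f ≤ posPartAux φ (c • f) := by
  rw [← le_div_iff₀' hc]
  refine posPartAux_le φ hf fun g hg hgf => ?_
  rw [le_div_iff₀' hc, ← smul_eq_mul, ← map_smul]
  exact le_posPartAux φ (smul_nonneg hc.le hg) (smul_le_smul_of_nonneg_left hgf hc.le)

theorem posPartAux_smul (φ : C(K, ℝ) →L[ℝ] ℝ) {f : C(K, ℝ)} (hf : 0 ≤ f) {c : ℝ} (hc : 0 ≤ c) :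
    posPartAux φ (c • f) = c * posPartAux φ f := by
  rcases hc.eq_or_lt with rfl | hc
  · simp [posPartAux]
  · refine le_antisymm ?_ (mul_posPartAux_le φ hf hc)
    have := mul_posPartAux_le φ (smul_nonneg hc.le hf) (inv_pos.2 hc)
    rw [inv_smul_smul₀ hc.ne', inv_mul_le_iff₀ hc] at this
    exact this

/-- The reflection `g ↦ f - g` preserves the interval `[0, f]` and exchanges the suprema for `φ` and
`-φ`, up to the constant `φ f`. -/
theorem posPartAux_sub_posPartAux_neg (φ : C(K, ℝ) →L[ℝ] ℝ) {f : C(K, ℝ)} (hf : 0 ≤ f) :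
    posPartAux φ f - posPartAux (-φ) f = φ f := by
  have key : ∀ ψ : C(K, ℝ) →L[ℝ] ℝ, posPartAux ψ f ≤ ψ f + posPartAux (-ψ) f := by
    intro ψ
    refine posPartAux_le ψ hf fun g hg hgf => ?_
    have := le_posPartAux (-ψ) (sub_nonneg.2 hgf) (sub_le_self f hg)
    simp only [neg_apply, map_sub] at this
    linarith
  have h1 := key φ
  have h2 := key (-φ)
  rw [neg_neg, neg_apply] at h2
  linarith

/-- A compactly supported `ℝ≥0`-valued function as a continuous real-valued function. -/
def realOfNNReal (f : C_c(K, ℝ≥0)) : C(K, ℝ) :=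
  ⟨fun x => (f x : ℝ), by fun_prop⟩

omit [CompactSpace K] in
theorem realOfNNReal_nonneg (f : C_c(K, ℝ≥0)) : 0 ≤ realOfNNReal f :=
  ContinuousMap.le_def.2 fun x => (f x).coe_nonneg

/-- The positive part of a functional on `C(K, ℝ)`, as an `ℝ≥0`-linear functional. -/
noncomputable def posPartFunctional (φ : C(K, ℝ) →L[ℝ] ℝ) : C_c(K, ℝ≥0) →ₗ[ℝ≥0] ℝ≥0 where
  toFun f := ⟨posPartAux φ (realOfNNReal f),
    posPartAux_nonneg φ (realOfNNReal_nonneg f)⟩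
  map_add' f g := by
    ext
    change posPartAux φ _ = posPartAux φ _ + posPartAux φ _
    exact posPartAux_add φ (realOfNNReal_nonneg f) (realOfNNReal_nonneg g)
  map_smul' c f := by
    ext
    change posPartAux φ _ = c * posPartAux φ _
    exact posPartAux_smul φ (realOfNNReal_nonneg f) c.coe_nonneg

variable [T2Space K] [MeasurableSpace K] [BorelSpace K]

/-- The positive part of a functional on `C(K, ℝ)`, as a measure. -/
noncomputable def posPartMeasure (φ : C(K, ℝ) →L[ℝ] ℝ) : Measure K :=
  NNRealRMK.rieszMeasure (posPartFunctional φ)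

instance (φ : C(K, ℝ) →L[ℝ] ℝ) : (posPartMeasure φ).Regular :=
  NNRealRMK.rieszMeasure_regular _

instance (φ : C(K, ℝ) →L[ℝ] ℝ) : IsFiniteMeasure (posPartMeasure φ) :=
  ⟨isCompact_univ.measure_lt_top⟩

/-- A nonnegative continuous function on a compact space as a compactly supported function. -/
noncomputable def nnrealCompactlySupported (f : C(K, ℝ)) : C_c(K, ℝ≥0) :=
  ⟨⟨fun x => (f x).toNNReal, by fun_prop⟩, HasCompactSupport.of_compactSpace _⟩

theorem lintegral_posPartMeasure (φ : C(K, ℝ) →L[ℝ] ℝ) {f : C(K, ℝ)} (hf : 0 ≤ f) :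
    ∫⁻ x, ENNReal.ofReal (f x) ∂posPartMeasure φ = ENNReal.ofReal (posPartAux φ f) := by
  have h := NNRealRMK.lintegral_rieszMeasure (posPartFunctional φ) (nnrealCompactlySupported f)
  have h2 : (posPartFunctional φ (nnrealCompactlySupported f) : ℝ≥0∞) =
      ENNReal.ofReal (posPartAux φ f) := by
    rw [← ENNReal.ofReal_coe_nnreal]
    congr 1
    change posPartAux φ _ = _
    congr 1
    ext x
    exact Real.coe_toNNReal (f x) (hf x)
  rw [h2] at h
  exact h

theorem eq_of_posPartMeasure_eq {φ ψ : C(K, ℝ) →L[ℝ] ℝ} (h : posPartMeasure φ = posPartMeasure ψ)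
    (h' : posPartMeasure (-φ) = posPartMeasure (-ψ)) : φ = ψ := by
  have key : ∀ {φ ψ : C(K, ℝ) →L[ℝ] ℝ}, posPartMeasure φ = posPartMeasure ψ →
      ∀ f, 0 ≤ f → posPartAux φ f = posPartAux ψ f := by
    intro φ ψ h f hf
    have h1 := lintegral_posPartMeasure φ hf
    rw [h, lintegral_posPartMeasure ψ hf] at h1
    exact ((ENNReal.ofReal_eq_ofReal_iff (posPartAux_nonneg ψ hf)
      (posPartAux_nonneg φ hf)).1 h1).symm
  have hpos : ∀ f, 0 ≤ f → φ f = ψ f := by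
    intro f hf
    rw [← posPartAux_sub_posPartAux_neg φ hf, ← posPartAux_sub_posPartAux_neg ψ hf,
      key h f hf, key h' f hf]
  ext f
  have hf : f = (f ⊔ 0) - ((-f) ⊔ 0) := by
    ext x
    simp only [ContinuousMap.coe_sub, Pi.sub_apply, ContinuousMap.sup_apply,
      ContinuousMap.coe_zero, Pi.zero_apply, ContinuousMap.coe_neg, Pi.neg_apply]
    rcases le_total (f x) 0 with h | h
    · rw [sup_eq_right.2 h, sup_eq_left.2 (neg_nonneg.2 h)]; ring
    · rw [sup_eq_left.2 h, sup_eq_right.2 (neg_nonpos.2 h)]; ring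
  rw [hf, map_sub, map_sub, hpos _ le_sup_right, hpos _ le_sup_right]

/-- Forwards, inner regularity gives a compact subset of `U`, and Urysohn gives a function whose
positive-part value exceeds `r`; the supremum then yields `g`. Backwards, `g` lies below the
indicator of `U`. This is what makes the measure of an open set weak* lower semicontinuous. -/
theorem lt_posPartMeasure_iff (φ : C(K, ℝ) →L[ℝ] ℝ) {U : Set K} (hU : IsOpen U) (r : ℝ≥0) :
    r < posPartMeasure φ U ↔
      ∃ g : C(K, ℝ), 0 ≤ g ∧ g ≤ 1 ∧ (∀ x ∉ U, g x = 0) ∧ (r : ℝ) < φ g := by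
  constructor
  · intro h
    obtain ⟨C, hCU, hC, hr⟩ := hU.exists_lt_isCompact h
    obtain ⟨f, hf0, hf1, hf⟩ := exists_continuous_zero_one_of_isClosed hU.isClosed_compl hC.isClosed
      (disjoint_left.2 fun x hx hx' => hx (hCU hx'))
    have hf' : (0 : C(K, ℝ)) ≤ f := fun x => (hf x).1
    have h1 : (r : ℝ≥0∞) < ENNReal.ofReal (posPartAux φ f) := by
      refine hr.trans_le ?_
      rw [← lintegral_posPartMeasure φ hf', ← lintegral_indicator_one hC.measurableSet]
      refine lintegral_mono fun x => ?_
      by_cases hx : x ∈ C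
      · simp [hx, hf1 hx]
      · simp [hx]
    rw [← ENNReal.ofReal_coe_nnreal, ENNReal.ofReal_lt_ofReal_iff_of_nonneg r.coe_nonneg] at h1
    obtain ⟨_, ⟨g, hg, rfl⟩, hgr⟩ := exists_lt_of_lt_csSup
      (Nonempty.image _ ⟨0, mem_Icc.2 ⟨le_rfl, hf'⟩⟩) h1
    exact ⟨g, hg.1, fun x => (hg.2 x).trans (hf x).2,
      fun x hx => le_antisymm ((hg.2 x).trans (hf0 hx).le) (hg.1 x), hgr⟩
  · rintro ⟨g, hg0, hg1, hgU, hgr⟩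
    calc (r : ℝ≥0∞) = ENNReal.ofReal r := ENNReal.ofReal_coe_nnreal.symm
      _ < ENNReal.ofReal (posPartAux φ g) :=
        (ENNReal.ofReal_lt_ofReal_iff_of_nonneg r.coe_nonneg).2
          (hgr.trans_le (le_posPartAux φ hg0 le_rfl))
      _ = ∫⁻ x, ENNReal.ofReal (g x) ∂posPartMeasure φ := (lintegral_posPartMeasure φ hg0).symm
      _ ≤ ∫⁻ x, U.indicator 1 x ∂posPartMeasure φ := by
        refine lintegral_mono fun x => ?_
        by_cases hx : x ∈ U
        · simpa [hx] using hg1 x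
        · simp [hx, hgU x hx]
      _ = posPartMeasure φ U := lintegral_indicator_one hU.measurableSet

theorem isOpen_setOf_lt_posPartMeasure {U : Set K} (hU : IsOpen U) (r : ℝ≥0) (s : ℝ) :
    IsOpen {φ : WeakDual ℝ C(K, ℝ) | r < posPartMeasure (s • WeakDual.toStrongDual φ) U} := by
  have : {φ : WeakDual ℝ C(K, ℝ) | r < posPartMeasure (s • WeakDual.toStrongDual φ) U} =
      ⋃ g ∈ {g : C(K, ℝ) | 0 ≤ g ∧ g ≤ 1 ∧ ∀ x ∉ U, g x = 0},
        {φ : WeakDual ℝ C(K, ℝ) | (r : ℝ) < s * φ g} := by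
    ext φ
    simp only [mem_ofPred_eq, mem_iUnion, lt_posPartMeasure_iff _ hU, exists_prop, and_assoc]
    rfl
  rw [this]
  exact isOpen_biUnion fun g _ =>
    isOpen_lt continuous_const (continuous_const.mul (WeakDual.eval_continuous g))

end PositivePart
end GruenhageSpaces
namespace GruenhageSpaces
open MeasureTheory Set
open scoped ENNReal NNReal

/-! ### Gruenhage families and their transfer to spaces of measures. -/

section Families

/-- A set meets a pair of distinct points in a singleton iff it contains exactly one of them. -/
theorem pair_inter_eq_singleton_iff {X : Type*} {x y : X} (hxy : x ≠ y) {U : Set X} :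
    (∃ z, {x, y} ∩ U = {z}) ↔ ¬ (x ∈ U ↔ y ∈ U) := by
  constructor
  · rintro ⟨z, hz⟩ h
    by_cases hx : x ∈ U
    · have h1 : x ∈ ({z} : Set X) := hz ▸ ⟨Or.inl rfl, hx⟩
      have h2 : y ∈ ({z} : Set X) := hz ▸ ⟨Or.inr rfl, h.1 hx⟩
      exact hxy (h1.trans h2.symm)
    · have h1 : z ∈ ({x, y} : Set X) ∩ U := hz ▸ rfl
      rcases h1 with ⟨rfl | rfl, hU⟩
      · exact hx hU
      · exact hx (h.2 hU)
  · intro h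
    by_cases hx : x ∈ U
    · have hy : y ∉ U := fun hy => h ⟨fun _ => hy, fun _ => hx⟩
      refine ⟨x, ?_⟩
      ext w
      constructor
      · rintro ⟨rfl | rfl, hU⟩
        · rfl
        · exact absurd hU hy
      · rintro rfl
        exact ⟨Or.inl rfl, hx⟩
    · have hy : y ∈ U := by
        by_contra hy
        exact h ⟨fun h' => absurd h' hx, fun h' => absurd h' hy⟩
      refine ⟨y, ?_⟩
      ext w
      constructor
      · rintro ⟨rfl | rfl, hU⟩
        · exact absurd hU hx
        · rfl
      · rintro rfl
        exact ⟨Or.inr rfl, hy⟩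

theorem isGruenhage_of_countable {X : Type*} [TopologicalSpace X] {ι : Type*} [Countable ι]
    [Nonempty ι] (𝒲 : ι → Set (Set X)) (hopen : ∀ c, ∀ U ∈ 𝒲 c, IsOpen U)
    (h : ∀ x y, x ≠ y → ∃ c, (∃ U ∈ 𝒲 c, ¬ (x ∈ U ↔ y ∈ U)) ∧
      ({U | U ∈ 𝒲 c ∧ x ∈ U}.Finite ∨ {U | U ∈ 𝒲 c ∧ y ∈ U}.Finite)) :
    IsGruenhage X := by
  obtain ⟨e, he⟩ := exists_surjective_nat ι
  have key : ∀ x y : X, x ≠ y → ∃ n : ℕ,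
      (∃ U ∈ 𝒲 (e n), ∃ z : X, {x, y} ∩ U = {z}) ∧
        (pointOrder x (𝒲 (e n)) < ⊤ ∨ pointOrder y (𝒲 (e n)) < ⊤) := by
    intro x y hxy
    obtain ⟨c, ⟨U, hU, hxU⟩, hfin⟩ := h x y hxy
    obtain ⟨n, rfl⟩ := he c
    exact ⟨n, ⟨U, hU, (pair_inter_eq_singleton_iff hxy).2 hxU⟩,
      hfin.imp Set.encard_lt_top_iff.2 Set.encard_lt_top_iff.2⟩
  refine ⟨⋃ n, 𝒲 (e n), ?_, ?_, fun n => 𝒲 (e n), rfl, key⟩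
  · intro U hU
    obtain ⟨n, hn⟩ := mem_iUnion.1 hU
    exact hopen _ U hn
  · intro x y hxy
    obtain ⟨n, ⟨U, hU, hz⟩, -⟩ := key x y hxy
    exact ⟨U, mem_iUnion.2 ⟨n, hU⟩, hz⟩

/-- In a Gruenhage space there are open sets `V a j` and `R a` such that, for each of the countably
many `a`, the sets `V a j \ R a` are pairwise disjoint, and together they separate points. -/
theorem IsGruenhage.exists_disjoint_families {X : Type*} [TopologicalSpace X]
    (h : IsGruenhage X) :
    ∃ (V : ℕ × ℕ → Finset (Set X) → Set X) (R : ℕ × ℕ → Set X),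
      (∀ a j, IsOpen (V a j)) ∧ (∀ a, IsOpen (R a)) ∧
      (∀ a, Pairwise fun j k => Disjoint (V a j \ R a) (V a k \ R a)) ∧
      ∀ x y, (∀ a j, x ∈ V a j \ R a ↔ y ∈ V a j \ R a) → x = y := by
  classical
  obtain ⟨𝒰, hopen, -, 𝒱, rfl, hsep⟩ := h
  have hopen' : ∀ n, ∀ U ∈ 𝒱 n, IsOpen U := fun n U hU => hopen U (mem_iUnion.2 ⟨n, hU⟩)
  -- For `a = (n, k)`, `R a` consists of the points of order at least `k + 1` in `𝒱 n`, so removing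
  -- it leaves the points whose containing members are exactly those of `F`.
  let V : ℕ × ℕ → Finset (Set X) → Set X := fun a F =>
    {x | (↑F ⊆ 𝒱 a.1 ∧ F.card = a.2) ∧ ∀ U ∈ F, x ∈ U}
  let R : ℕ × ℕ → Set X := fun a =>
    ⋃ F ∈ {F : Finset (Set X) | ↑F ⊆ 𝒱 a.1 ∧ F.card = a.2 + 1}, ⋂ U ∈ F, U
  have hmem : ∀ a F x, x ∈ V a F \ R a ↔
      F.card = a.2 ∧ ∀ U, U ∈ F ↔ U ∈ 𝒱 a.1 ∧ x ∈ U := by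
    intro a F x
    constructor
    · rintro ⟨⟨⟨hF, hc⟩, hx⟩, hxR⟩
      refine ⟨hc, fun U => ⟨fun hU => ⟨hF hU, hx U hU⟩, fun hU => ?_⟩⟩
      by_contra hUF
      refine hxR (mem_iUnion₂.2 ⟨insert U F, ⟨?_, ?_⟩, ?_⟩)
      · rw [Finset.coe_insert]
        exact insert_subset hU.1 hF
      · rw [Finset.card_insert_of_notMem hUF, hc]
      · refine mem_iInter₂.2 fun W hW => ?_
        rcases Finset.mem_insert.1 hW with rfl | hW
        · exact hU.2
        · exact hx W hW
    · rintro ⟨hc, hF⟩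
      refine ⟨⟨⟨fun U hU => ((hF U).1 hU).1, hc⟩, fun U hU => ((hF U).1 hU).2⟩, fun hxR => ?_⟩
      obtain ⟨G, ⟨hG, hGc⟩, hxG⟩ := mem_iUnion₂.1 hxR
      have : G ⊆ F := fun U hU => (hF U).2 ⟨hG hU, mem_iInter₂.1 hxG U hU⟩
      have := Finset.card_le_card this
      omega
  refine ⟨V, R, fun a F => ?_, fun a => ?_, fun a F G hFG => ?_, fun x y hxy => ?_⟩
  · by_cases hF : ↑F ⊆ 𝒱 a.1 ∧ F.card = a.2
    · have : V a F = ⋂ U ∈ F, U := by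
        ext x
        simp [V, hF]
      rw [this]
      exact isOpen_biInter_finset fun U hU => hopen' _ U (hF.1 hU)
    · have : V a F = ∅ := by
        ext x
        exact ⟨fun hx => hF hx.1, fun hx => hx.elim⟩
      rw [this]
      exact isOpen_empty
  · exact isOpen_biUnion fun F hF => isOpen_biInter_finset fun U hU => hopen' _ U (hF.1 hU)
  · refine disjoint_left.2 fun x hx hx' => hFG ?_
    ext U
    rw [((hmem a F x).1 hx).2, ((hmem a G x).1 hx').2]
  · by_contra hne
    obtain ⟨n, ⟨U, hU, hz⟩, hfin⟩ := hsep x y hne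
    have hxU := (pair_inter_eq_singleton_iff hne).1 hz
    -- If `z` has finite order, the members containing it form an admissible `F`; sharing that piece
    -- forces `w` to lie in the same members.
    have aux : ∀ z w : X, (∀ a j, z ∈ V a j \ R a ↔ w ∈ V a j \ R a) →
        pointOrder z (𝒱 n) < ⊤ → (z ∈ U ↔ w ∈ U) := by
      intro z w hzw hz
      have hf : {U | U ∈ 𝒱 n ∧ z ∈ U}.Finite := Set.encard_lt_top_iff.1 hz
      have hzF : z ∈ V (n, hf.toFinset.card) hf.toFinset \ R (n, hf.toFinset.card) :=
        (hmem _ _ _).2 ⟨rfl, fun W => by simp⟩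
      have h1 := ((hmem _ _ _).1 hzF).2 U
      have h2 := ((hmem _ _ _).1 ((hzw _ _).1 hzF)).2 U
      have h3 := h1.symm.trans h2
      exact ⟨fun hz => (h3.1 ⟨hU, hz⟩).2, fun hw => (h3.2 ⟨hU, hw⟩).2⟩
    rcases hfin with hx | hy
    · exact hxU (aux x y hxy hx)
    · exact hxU (aux y x (fun a j => (hxy a j).symm) hy).symm

/-- A space is Gruenhage if its points are distinguished by countably many lower semicontinuous
maps into the finite regular measures on a Gruenhage space. -/
theorem isGruenhage_of_measures {K : Type*} [TopologicalSpace K] [T2Space K] [MeasurableSpace K]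
    [BorelSpace K] (hK : IsGruenhage K) {Y κ : Type*} [TopologicalSpace Y] [Countable κ]
    [Nonempty κ] (m : κ → Y → Measure K) [∀ s φ, IsFiniteMeasure (m s φ)]
    [∀ s φ, (m s φ).InnerRegular]
    (hlsc : ∀ s U, IsOpen U → ∀ r : ℝ≥0, IsOpen {φ | (r : ℝ≥0∞) < m s φ U})
    (hinj : ∀ φ ψ, (∀ s, m s φ = m s ψ) → φ = ψ) : IsGruenhage Y := by
  classical
  obtain ⟨V, R, hV, hR, hdisj, hsep⟩ := hK.exists_disjoint_families
  let RA : Finset (ℕ × ℕ) → Set K := fun A => ⋃ a ∈ A, R a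
  -- Adjoining `RA A` does not change the difference with `RA A`, and makes `G A i` an open superset
  -- of it.
  let G : (A : Finset (ℕ × ℕ)) → (A → Finset (Set K)) → Set K := fun A i =>
    (⋂ a : A, V a (i a)) ∪ RA A
  have hRA : ∀ A, IsOpen (RA A) := fun A => isOpen_biUnion fun a _ => hR a
  have hG : ∀ A i, IsOpen (G A i) := fun A i =>
    (isOpen_iInter_of_finite fun a => hV _ _).union (hRA A)
  have hGR : ∀ A i, G A i \ RA A = ⋂ a : A, V a (i a) \ R a := by
    intro A i
    ext x
    simp only [G, RA, mem_sdiff, mem_union, mem_iInter, mem_iUnion, Subtype.forall, not_exists]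
    constructor
    · rintro ⟨h | h, h'⟩ a ha
      · exact ⟨h a ha, h' a ha⟩
      · obtain ⟨b, hb, hx⟩ := h
        exact absurd hx (h' b hb)
    · exact fun h => ⟨Or.inl fun a ha => (h a ha).1, fun a ha => (h a ha).2⟩
  have hsub : ∀ A i, RA A ⊆ G A i := fun A i => subset_union_right
  -- The flag `true` gives a one-element family testing `RA`; `false` gives the possibly infinite
  -- family testing all the `G A i`.
  let 𝒲 : κ × Finset (ℕ × ℕ) × ℚ × Bool → Set (Set (Y)) := fun c =>
    if c.2.2.2 then {{φ | (Real.toNNReal c.2.2.1 : ℝ≥0∞) < m c.1 φ (RA c.2.1)}}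
    else range fun i => {φ | (Real.toNNReal c.2.2.1 : ℝ≥0∞) < m c.1 φ (G c.2.1 i)}
  refine isGruenhage_of_countable 𝒲 ?_ ?_
  · rintro ⟨s, A, q, b⟩ U hU
    cases b
    · obtain ⟨i, rfl⟩ := hU
      exact hlsc s _ (hG A i) _
    · obtain rfl := hU
      exact hlsc s _ (hRA A) _
  · -- a point of finite order for a family indexed by `i`
    have hfin : ∀ s A (q : ℚ) φ, m s φ (RA A) < (Real.toNNReal q : ℝ≥0∞) →
        {U | U ∈ 𝒲 (s, A, q, false) ∧ φ ∈ U}.Finite := by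
      intro s A q φ hq
      -- These differences are disjoint, so only finitely many can have mass above a fixed positive
      -- bound.
      have h1 : {i | (Real.toNNReal q : ℝ≥0∞) - m s φ (RA A) ≤ m s φ (G A i \ RA A)}.Finite := by
        refine Measure.finite_const_le_meas_of_disjoint_iUnion _ (tsub_pos_of_lt hq)
          (fun i => (hG A i).measurableSet.diff (hRA A).measurableSet) ?_ (measure_ne_top _ _)
        intro i k hik
        obtain ⟨a, ha⟩ := Function.ne_iff.1 hik
        simp only [Function.onFun, hGR]
        exact (hdisj a ha).mono (iInter_subset _ a) (iInter_subset _ a)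
      refine (h1.image fun i => {φ | (Real.toNNReal q : ℝ≥0∞) < m s φ (G A i)}).subset ?_
      rintro _ ⟨⟨i, rfl⟩, hφ⟩
      refine ⟨i, ?_, rfl⟩
      have hφ' : (Real.toNNReal q : ℝ≥0∞) < m s φ (G A i) := hφ
      change _ ≤ m s φ (G A i \ RA A)
      rw [measure_sdiff (hsub A i) (hRA A).nullMeasurableSet (measure_ne_top _ _)]
      exact tsub_le_tsub_right hφ'.le _
    intro φ ψ hne
    by_contra! hcon
    -- the measures agree on all `RA A` and `G A i`
    have hR_eq : ∀ s A, m s φ (RA A) = m s ψ (RA A) := by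
      intro s A
      by_contra hne
      have hf : ∀ (q : ℚ) χ, {U | U ∈ 𝒲 (s, A, q, true) ∧ χ ∈ U}.Finite := fun q χ =>
        (finite_singleton _).subset fun U hU => hU.1
      rcases lt_or_gt_of_ne hne with h | h
      all_goals
        obtain ⟨q, -, h1, h2⟩ := ENNReal.lt_iff_exists_rat_btwn.1 h
        refine (hcon (s, A, q, true) ⟨_, rfl, ?_⟩).1 (hf q φ)
      · exact Or.inr ⟨h1.not_gt, h2⟩
      · exact Or.inl ⟨h2, h1.not_gt⟩
    have hG_eq : ∀ s A i, m s φ (G A i) = m s ψ (G A i) := by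
      intro s A i
      by_contra hne
      rcases lt_or_gt_of_ne hne with h | h
      all_goals obtain ⟨q, -, h1, h2⟩ := ENNReal.lt_iff_exists_rat_btwn.1 h
      -- Of the two functionals, the one giving `G A i` less mass has finite order, because `RA A ⊆
      -- G A i` then also has mass below `q`.
      · refine (hcon (s, A, q, false) ⟨_, ⟨i, rfl⟩, Or.inr ⟨h1.not_gt, h2⟩⟩).1
          (hfin s A q φ ((measure_mono (hsub A i)).trans_lt h1))
      · refine (hcon (s, A, q, false) ⟨_, ⟨i, rfl⟩, Or.inl ⟨h2, h1.not_gt⟩⟩).2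
          (hfin s A q ψ ((measure_mono (hsub A i)).trans_lt h1))
    have hmeq : ∀ s, m s φ = m s ψ := by
      intro s
      have hagree : ∀ (A : Finset (ℕ × ℕ)) (i : ℕ × ℕ → Finset (Set K)),
          m s φ (⋂ a ∈ A, V a (i a) \ R a) = m s ψ (⋂ a ∈ A, V a (i a) \ R a) := by
        intro A i
        have : ⋂ a ∈ A, V a (i a) \ R a = G A (fun a => i a) \ RA A := by
          rw [hGR]
          ext x
          simp
        rw [this, measure_sdiff (hsub A _) (hRA A).nullMeasurableSet (measure_ne_top _ _),
          measure_sdiff (hsub A _) (hRA A).nullMeasurableSet (measure_ne_top _ _), hG_eq, hR_eq]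
      refine measure_ext_of_disjoint_families hV hR hdisj hsep _ _ hagree ?_
      -- The empty intersection is the whole space, which gives equal total mass.
      simpa using hagree ∅ fun _ => ∅
    exact hne (hinj φ ψ hmeq)

theorem IsGruenhage.subtype {X : Type*} [TopologicalSpace X] (h : IsGruenhage X) (s : Set X) :
    IsGruenhage s := by
  obtain ⟨𝒰, hopen, -, 𝒱, rfl, hsep⟩ := h
  refine isGruenhage_of_countable (fun n => (fun U => Subtype.val ⁻¹' U) '' 𝒱 n) ?_ ?_
  · rintro n _ ⟨U, hU, rfl⟩
    exact (hopen U (mem_iUnion.2 ⟨n, hU⟩)).preimage continuous_subtype_val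
  · intro x y hxy
    have hne : (x : X) ≠ y := fun h => hxy (Subtype.ext h)
    obtain ⟨n, ⟨U, hU, hz⟩, hfin⟩ := hsep x y hne
    have aux : ∀ z : s, pointOrder (z : X) (𝒱 n) < ⊤ →
        {W | W ∈ (fun U => (Subtype.val ⁻¹' U : Set s)) '' 𝒱 n ∧ z ∈ W}.Finite := by
      intro z hz
      refine ((Set.encard_lt_top_iff.1 hz).image fun U => (Subtype.val ⁻¹' U : Set s)).subset ?_
      rintro _ ⟨⟨U, hU, rfl⟩, hzU⟩
      exact ⟨U, ⟨hU, hzU⟩, rfl⟩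
    exact ⟨n, ⟨_, ⟨U, hU, rfl⟩, (pair_inter_eq_singleton_iff hne).1 hz⟩,
      hfin.imp (aux x) (aux y)⟩

end Families

/-! ### The dual ball of `C(K, ℝ)`. -/

section DualBall

variable {K : Type*} [TopologicalSpace K] [CompactSpace K]

instance : T2Space (dualUnitBall C(K, ℝ)) :=
  inferInstanceAs (T2Space {f : WeakDual ℝ C(K, ℝ) | ‖WeakDual.toStrongDual f‖ ≤ 1})

theorem compactSpace_dualUnitBall (E : Type*) [NormedAddCommGroup E] [NormedSpace ℝ E] :
    CompactSpace (dualUnitBall E) := by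
  have h : dualUnitBall E = WeakDual.toStrongDual ⁻¹' Metric.closedBall 0 1 := by
    ext f
    simp [dualUnitBall]
  rw [h, ← isCompact_iff_compactSpace]
  exact WeakDual.isCompact_closedBall (𝕜 := ℝ) (E := E) 0 1

variable [T2Space K] [MeasurableSpace K] [BorelSpace K]

/-- The weak* dual of `C(K, ℝ)` is Gruenhage if `K` is a Gruenhage compact space. -/
theorem isGruenhage_weakDual (hK : IsGruenhage K) : IsGruenhage (WeakDual ℝ C(K, ℝ)) := by
  refine isGruenhage_of_measures hK
    -- The two units `1` and `-1` index the positive and the negative part.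
    (fun (s : ℤˣ) (φ : WeakDual ℝ C(K, ℝ)) =>
      posPartMeasure (((s : ℤ) : ℝ) • WeakDual.toStrongDual φ))
    (fun s U hU r => isOpen_setOf_lt_posPartMeasure hU r _) fun φ ψ h => ?_
  have h1 : posPartMeasure (WeakDual.toStrongDual φ) =
      posPartMeasure (WeakDual.toStrongDual ψ) := by
    have := h 1
    rwa [Units.val_one, Int.cast_one, one_smul, one_smul] at this
  have h2 : posPartMeasure (-WeakDual.toStrongDual φ) =
      posPartMeasure (-WeakDual.toStrongDual ψ) := by
    have hneg (f : C(K, ℝ) →L[ℝ] ℝ) : (((-1 : ℤˣ) : ℤ) : ℝ) • f = -f := by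
      ext
      simp
    rw [← hneg, ← hneg]
    exact h (-1)
  exact WeakDual.toStrongDual.injective (eq_of_posPartMeasure_eq h1 h2)

end DualBall
end GruenhageSpaces

/-- `C(K, ℝ)` carries the supremum norm, and the ball the subspace topology of the weak* topology.
The instance argument `CompactSpace K` is only there for the norm of `C(K, ℝ)`; it is also part of
the hypothesis `hK`. -/
theorem proposition5p4 (K : Type*) [TopologicalSpace K] [CompactSpace K]
    (hK : GruenhageSpaces.IsGruenhageCompact K) :
    GruenhageSpaces.IsGruenhageCompact (GruenhageSpaces.dualUnitBall C(K, ℝ)) := by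
  have := hK.hausdorff
  let _ : MeasurableSpace K := borel K
  have : BorelSpace K := ⟨rfl⟩
  exact ⟨GruenhageSpaces.compactSpace_dualUnitBall _, inferInstance,
    (GruenhageSpaces.isGruenhage_weakDual hK.gruenhage).subtype _⟩
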